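/- A polytope in $\mathbb{R}^d$ is the convex hull of a nonempty finite set of points; its dimension is that of its affine hull. For a polytope $P\subset\mathbb{R}^d$ and a direction $y\in\mathbb{R}^d$ (acting by $x\mapsto \sum_i y_i x_i$) let $P_y$ be the $y$-maximal face of $P$, i.e. the set of points of $P$ at which $y$ attains its maximum over $P$. A face of $P$ is a nonempty intersection of $P$ with the boundary $\{a\cdot x=b\}$ of a halfspace $\{a\cdot x\le b\}$ containing $P$ ($a=0$, $b=0$ is allowed, so $P$ is a face of itself), and a $k$-face is a face of dimension $k$. The normal cone of a face $F$ is $N_P(F)=\{y : P_y\supseteq F\}$, and the normal fan of $P$ is the collection of the normal cones of all faces of $P$. The polytope $P$ is a generalized permutahedron if every cone of its normal fan is a union of cones of the normal fan of the standard permutahedron, the convex hull of all permutations of $(1,2,\dots,d)$. Write $[m]=\{1,\dots,m\}$. Theorem. Let $P\subset\mathbb{R}^d$ be a generalized permutahedron and $k\in\{0,\dots,d-1\}$. For positive integers $m$ let $$\chi_{d,k}(P)(m)=\#\{y\in[m]^d : P_y \text{ is a } k\text{-face}\}.$$ Then there is a polynomial, also denoted $\chi_{d,k}(P)$, that agrees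 with this function at all positive integers $m$; it has degree exactly $d-k$ if $k\le\dim P$, and it is the zero polynomial if $k>\dim P$. Moreover, for every positive integer $m$, $$(-1)^{d-k}\,\chi_{d,k}(P)(-m)=\sum_{y\in[m]^d}\#\{k\text{-faces of } P_y\}.$$ -/

import Mathlib

namespace GenPerm

/-- A (nonempty) polytope in `ℝ^d`: the convex hull of a nonempty finite set of points. -/
def IsPolytope {d : ℕ} (P : Set (Fin d → ℝ)) : Prop :=
  ∃ S : Set (Fin d → ℝ), S.Finite ∧ S.Nonempty ∧ P = convexHull ℝ S

/-- The dimension of a nonempty set: the dimension of its affine hull. -/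
noncomputable def dim {d : ℕ} (Q : Set (Fin d → ℝ)) : ℕ :=
  Module.finrank ℝ (affineSpan ℝ Q).direction

/-- The action of the direction `y` as a linear functional on `ℝ^d`. -/
def pairing {d : ℕ} (y x : Fin d → ℝ) : ℝ := ∑ i, x i * y i

/-- The `y`-maximal face `P_y`. -/
def maxFace {d : ℕ} (P : Set (Fin d → ℝ)) (y : Fin d → ℝ) : Set (Fin d → ℝ) :=
  {x | x ∈ P ∧ ∀ x' ∈ P, pairing y x' ≤ pairing y x}

/-- `F` is a (nonempty) face of `P`: the intersection of `P` with the boundary `a · x = b` of a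
halfspace `a · x ≤ b` that contains `P`; the case `a = 0`, `b = 0` makes `P` a face of itself. -/
def IsFace {d : ℕ} (P F : Set (Fin d → ℝ)) : Prop :=
  F.Nonempty ∧ ∃ (a : Fin d → ℝ) (b : ℝ),
    (∀ x ∈ P, pairing a x ≤ b) ∧ F = {x | x ∈ P ∧ pairing a x = b}

/-- The closed normal cone `N_P(F)`: all directions that are maximized on all of `F`. -/
def normalCone {d : ℕ} (P F : Set (Fin d → ℝ)) : Set (Fin d → ℝ) :=
  {y | F ⊆ maxFace P y}

/-- The normal fan: the collection of the normal cones of all faces. -/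
def normalFan {d : ℕ} (P : Set (Fin d → ℝ)) : Set (Set (Fin d → ℝ)) :=
  {N | ∃ F, IsFace P F ∧ N = normalCone P F}

/-- `𝒩` is a coarsening of `𝒩'`: every cone of `𝒩` is the union of some cones of `𝒩'`. -/
def IsCoarsening {d : ℕ} (𝒩 𝒩' : Set (Set (Fin d → ℝ))) : Prop :=
  ∀ N ∈ 𝒩, ∃ S ⊆ 𝒩', N = ⋃₀ S

/-- The standard permutahedron: the convex hull of the permutations of `(1, 2, …, d)`. -/
def stdPermutahedron (d : ℕ) : Set (Fin d → ℝ) :=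
  convexHull ℝ (Set.range fun σ : Equiv.Perm (Fin d) => fun i => ((σ i : ℕ) : ℝ) + 1)

/-- A generalized permutahedron: a polytope whose normal fan is a coarsening of the normal fan of
the standard permutahedron. -/
def IsGeneralizedPermutahedron {d : ℕ} (P : Set (Fin d → ℝ)) : Prop :=
  IsPolytope P ∧ IsCoarsening (normalFan P) (normalFan (stdPermutahedron d))

/-- The finite set `[m]^d` of integer directions. -/
def box (d m : ℕ) : Finset (Fin d → ℕ) := Fintype.piFinset fun _ => Finset.Icc 1 m

/-- An integer direction as a real one. -/
def toDir {d : ℕ} (y : Fin d → ℕ) : Fin d → ℝ := fun i => (y i : ℝ)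

open Classical in
/-- `χ_{d,k}(P)(m)`: the number of `y ∈ [m]^d` whose `y`-maximal face has dimension `k`. -/
noncomputable def chi {d : ℕ} (k : ℕ) (P : Set (Fin d → ℝ)) (m : ℕ) : ℕ :=
  ((box d m).filter fun y => dim (maxFace P (toDir y)) = k).card

/-- The number of `k`-dimensional faces of a polytope. -/
noncomputable def numFaces {d : ℕ} (k : ℕ) (Q : Set (Fin d → ℝ)) : ℕ :=
  {F | IsFace Q F ∧ dim F = k}.ncard

end GenPerm

/-!
Let `F` be a face of a generalized permutahedron `P`. Its normal cone is a convex union of faces of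
the braid arrangement, and every such cone is cut out by inequalities `y i ≤ y j`: it consists of
the functions on `[d]` that are weakly increasing along a preorder `r`. So `P_y ⊇ F` means that `y`
is weakly increasing along `r`, while `P_y = F` means that `y` is not on a proper face of the cone,
i.e. that `y` is strictly increasing along `r`; and `d - dim F` is the number of classes of `r`.

Counting maps to `[m]` of these two kinds, one gets Stanley's reciprocity for order polynomials. If
`a` and `b` are incomparable, splitting by the sign of `y a - y b` expresses both counts through the
preorders that put `a` below `b`, above `b`, or into its class. What remains are the total
preorders, for which the counts are the binomial coefficients `m.choose n` and `m.multichoose n`.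

The theorem is the sum of these identities over the `k`-faces `F`. The degree is `d - k` because
the leading coefficients are positive and `P` has a face of every dimension up to its own: if `r` is
not symmetric, merging two adjacent classes of `r` leads from `F` to a face of dimension one higher.
-/

namespace GenPerm

section Reciprocal

open Polynomial

/-- `f` and `g` are the two sides of a reciprocity law of degree `n`: on the positive integers `f`
is a polynomial of degree `n` with positive leading coefficient, whose values at the negative
integers are those of `g` up to the sign `(-1) ^ n`. -/
def Reciprocal (n : ℕ) (f g : ℕ → ℕ) : Prop :=
  ∃ p : ℚ[X], (∀ m : ℕ, 0 < m → p.eval (m : ℚ) = f m) ∧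
    (∀ m : ℕ, 0 < m → (-1 : ℚ) ^ n * p.eval (-(m : ℚ)) = g m) ∧
    p.natDegree ≤ n ∧ 0 < p.coeff n

variable {n : ℕ} {f g f₁ g₁ f₂ g₂ f₃ g₃ : ℕ → ℕ}

theorem Reciprocal.add (h₁ : Reciprocal n f₁ g₁) (h₂ : Reciprocal n f₂ g₂) :
    Reciprocal n (f₁ + f₂) (g₁ + g₂) := by
  obtain ⟨p, hpf, hpg, hpn, hp⟩ := h₁
  obtain ⟨q, hqf, hqg, hqn, hq⟩ := h₂
  refine ⟨p + q, fun m hm => ?_, fun m hm => ?_, natDegree_add_le_of_degree_le hpn hqn, ?_⟩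
  · simp [hpf m hm, hqf m hm]
  · simp [mul_add, hpg m hm, hqg m hm]
  · simpa using add_pos hp hq

theorem Reciprocal.sum {ι : Type*} {s : Finset ι} (hs : s.Nonempty) {f g : ι → ℕ → ℕ}
    (h : ∀ i ∈ s, Reciprocal n (f i) (g i)) : Reciprocal n (∑ i ∈ s, f i) (∑ i ∈ s, g i) := by
  induction hs using Finset.Nonempty.cons_induction with
  | singleton i => simpa using h i
  | cons i s hi _ ih =>
    simp only [Finset.sum_cons]
    exact (h i (Finset.mem_cons_self i s)).add
      (ih fun j hj => h j (Finset.mem_cons_of_mem hj))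

theorem Reciprocal.add_of_succ (h : Reciprocal (n + 1) f g) (h₃ : Reciprocal n f₃ g₃)
    (hf : ∀ m, f₁ m = f m + f₃ m) (hg : ∀ m, g m = g₁ m + g₃ m) :
    Reciprocal (n + 1) f₁ g₁ := by
  obtain ⟨p, hpf, hpg, hpn, hp⟩ := h
  obtain ⟨q, hqf, hqg, hqn, -⟩ := h₃
  refine ⟨p + q, fun m hm => ?_, fun m hm => ?_,
    natDegree_add_le_of_degree_le hpn (hqn.trans n.le_succ), ?_⟩
  · simp [hf, hpf m hm, hqf m hm]
  · have hgm := congrArg (Nat.cast (R := ℚ)) (hg m)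
    rw [Nat.cast_add, ← hpg m hm, ← hqg m hm] at hgm
    rw [eval_add]
    linear_combination hgm
  · rwa [coeff_add, coeff_eq_zero_of_natDegree_lt (Nat.lt_succ_of_le hqn), add_zero]

theorem reciprocal_choose_multichoose (n : ℕ) :
    Reciprocal n (fun m => m.choose n) (fun m => m.multichoose n) := by
  have hn : (n.factorial : ℚ) ≠ 0 := by positivity
  refine ⟨C (n.factorial : ℚ)⁻¹ * descPochhammer ℚ n, fun m _ => ?_, fun m _ => ?_, ?_, ?_⟩
  · rw [eval_C_mul, descPochhammer_eval_eq_descFactorial, Nat.descFactorial_eq_factorial_mul_choose,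
      Nat.cast_mul, inv_mul_cancel_left₀ hn]
  · have hneg := ascPochhammer_eval_neg_eq_descPochhammer (R := ℚ) (-(m : ℚ)) n
    rw [neg_neg] at hneg
    rw [eval_C_mul, mul_left_comm, ← hneg, ← ascPochhammer_eval_cast,
      ascPochhammer_nat_eq_descFactorial, Nat.descFactorial_eq_factorial_mul_choose,
      ← Nat.multichoose_eq, Nat.cast_mul, inv_mul_cancel_left₀ hn]
  · exact (natDegree_C_mul_le _ _).trans (descPochhammer_natDegree ℚ n).le
  · have hlead := (monic_descPochhammer ℚ n).coeff_natDegree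
    rw [descPochhammer_natDegree] at hlead
    rw [coeff_C_mul, hlead]
    positivity

end Reciprocal

/-! ### Order polynomials of preorders -/

/-- `y` is weakly increasing along the relation `r`. -/
def MonotoneAlong {α β : Type*} [LE β] (r : α → α → Prop) (y : α → β) : Prop :=
  ∀ ⦃i j⦄, r i j → y i ≤ y j

/-- `y` is weakly increasing along the relation `r` and strictly increasing along the asymmetric
part of `r`; the latter is put in contrapositive form. -/
def StrictMonoAlong {α β : Type*} [LE β] (r : α → α → Prop) (y : α → β) : Prop :=
  ∀ ⦃i j⦄, r i j → y i ≤ y j ∧ (y j ≤ y i → r j i)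

/-- The relation obtained from a preorder `r` by declaring `a` to lie below `b`. -/
def insertRel {α : Type*} (r : α → α → Prop) (a b : α) : α → α → Prop :=
  fun i j => r i j ∨ r i a ∧ r b j

theorem StrictMonoAlong.monotoneAlong {α β : Type*} [LE β] {r : α → α → Prop} {y : α → β}
    (hy : StrictMonoAlong r y) : MonotoneAlong r y := fun _ _ hij => (hy hij).1

section InsertRel

variable {α β : Type*} {r : α → α → Prop} {a b : α}

theorem le_insertRel : r ≤ insertRel r a b := fun _ _ => Or.inl

variable [IsPreorder α r]

theorem insertRel_self : insertRel r a b a b := Or.inr ⟨refl_of r a, refl_of r b⟩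

instance : IsPreorder α (insertRel r a b) where
  refl i := Or.inl (refl_of r i)
  trans := by
    rintro i j k (hij | ⟨hia, hbj⟩) (hjk | ⟨hja, hbk⟩)
    · exact Or.inl (trans_of r hij hjk)
    · exact Or.inr ⟨trans_of r hij hja, hbk⟩
    · exact Or.inr ⟨hia, trans_of r hbj hjk⟩
    · exact Or.inr ⟨hia, hbk⟩

theorem lt_insertRel (hab : ¬ r a b) : r < insertRel r a b :=
  lt_of_le_not_ge le_insertRel fun h => hab (h a b insertRel_self)

theorem preorder_induction [Finite α] {motive : (α → α → Prop) → Prop}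
    (total : ∀ r [IsPreorder α r], (∀ i j, r i j ∨ r j i) → motive r)
    (split : ∀ r [IsPreorder α r] a b, ¬ r a b → ¬ r b a → motive (insertRel r a b) →
      motive (insertRel r b a) → motive (insertRel (insertRel r a b) b a) → motive r)
    (r : α → α → Prop) [hr : IsPreorder α r] : motive r := by
  induction r using WellFoundedGT.induction generalizing hr with
  | _ r ih =>
    by_cases htotal : ∀ i j, r i j ∨ r j i
    · exact total r htotal
    · push Not at htotal
      obtain ⟨a, b, hab, hba⟩ := htotal
      exact split r a b hab hba (ih _ (lt_insertRel hab)) (ih _ (lt_insertRel hba))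
        (ih _ ((lt_insertRel hab).trans_le le_insertRel))

theorem monotoneAlong_insertRel [Preorder β] {y : α → β} :
    MonotoneAlong (insertRel r a b) y ↔ MonotoneAlong r y ∧ y a ≤ y b := by
  constructor
  · exact fun hy => ⟨fun i j hij => hy (le_insertRel i j hij), hy insertRel_self⟩
  · rintro ⟨hy, hab⟩ i j (hij | ⟨hia, hbj⟩)
    · exact hy hij
    · exact (hy hia).trans (hab.trans (hy hbj))

theorem strictMonoAlong_insertRel [Preorder β] (hba : ¬ r b a) {y : α → β} :
    StrictMonoAlong (insertRel r a b) y ↔ StrictMonoAlong r y ∧ y a < y b := by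
  constructor
  · intro hy
    have hba' : ¬ insertRel r a b b a := by
      rintro (h | ⟨h, -⟩) <;> exact hba h
    have hab := hy insertRel_self
    refine ⟨fun _ _ hij => ?_, hab.1.lt_of_not_ge fun h => hba' (hab.2 h)⟩
    refine ⟨(hy (Or.inl hij)).1, fun hji => ((hy (Or.inl hij)).2 hji).resolve_right ?_⟩
    exact fun ⟨hja, hbi⟩ => hba (trans_of r hbi (trans_of r hij hja))
  · rintro ⟨hy, hab⟩ i j (hij | ⟨hia, hbj⟩)
    · exact ⟨(hy hij).1, fun hji => Or.inl ((hy hij).2 hji)⟩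
    · have hlt := (hy hia).1.trans_lt (hab.trans_le (hy hbj).1)
      exact ⟨hlt.le, fun hji => absurd hji hlt.not_ge⟩

theorem strictMonoAlong_insertRel_insertRel [PartialOrder β] (hab : ¬ r a b) (hba : ¬ r b a)
    {y : α → β} :
    StrictMonoAlong (insertRel (insertRel r a b) b a) y ↔ StrictMonoAlong r y ∧ y a = y b := by
  have hle : r ≤ insertRel (insertRel r a b) b a := le_insertRel.trans le_insertRel
  have mem_ab : insertRel (insertRel r a b) b a a b := le_insertRel _ _ insertRel_self
  have mem_ba : insertRel (insertRel r a b) b a b a := insertRel_self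
  constructor
  · intro hy
    refine ⟨fun i j hij => ⟨(hy (hle i j hij)).1, fun hyji => ?_⟩,
      (hy mem_ab).1.antisymm (hy mem_ba).1⟩
    have hji := (hy (hle i j hij)).2 hyji
    have htrans : ∀ x y z, r x y → r y z → r x z := fun _ _ _ => trans_of r
    unfold insertRel at hji
    grind
  · rintro ⟨hy, hyab⟩ i j hij
    have hmono : MonotoneAlong (insertRel (insertRel r a b) b a) y :=
      monotoneAlong_insertRel.2 ⟨monotoneAlong_insertRel.2 ⟨hy.monotoneAlong, hyab.le⟩, hyab.ge⟩
    refine ⟨hmono hij, fun hyji => ?_⟩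
    -- A step `i ≤ c ~ e ≤ j` with `y i = y j` is an equality throughout, hence can be reversed.
    have reverse : ∀ c e, r i c → r e j → insertRel (insertRel r a b) b a e c →
        insertRel (insertRel r a b) b a c e → insertRel (insertRel r a b) b a j i := by
      intro c e hic hej hec hce
      have hci : r c i := (hy hic).2 ((hmono hce).trans ((hy hej).1.trans hyji))
      have hje : r j e := (hy hej).2 (hyji.trans ((hy hic).1.trans (hmono hce)))
      exact trans_of _ (hle _ _ hje) (trans_of _ hec (hle _ _ hci))
    rcases hij with (hij | ⟨hia, hbj⟩) | ⟨hib | ⟨hia, -⟩, haj | ⟨-, hbj⟩⟩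
    · exact hle _ _ ((hy hij).2 hyji)
    · exact reverse a b hia hbj mem_ba mem_ab
    · exact reverse b a hib haj mem_ab mem_ba
    · exact reverse b b hib hbj (refl_of _ b) (refl_of _ b)
    · exact reverse a a hia haj (refl_of _ a) (refl_of _ a)
    · exact reverse a b hia hbj mem_ba mem_ab

end InsertRel

/-- The functions that are constant on the classes of the preorder `r`. Its dimension is the number
of classes. -/
def levelSubspace {α : Type*} (r : α → α → Prop) : Submodule ℝ (α → ℝ) where
  carrier := {y | ∀ ⦃i j⦄, r i j → r j i → y i = y j}
  add_mem' hx hy _ _ hij hji := congrArg₂ (· + ·) (hx hij hji) (hy hij hji)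
  zero_mem' _ _ _ _ := rfl
  smul_mem' c _ hx _ _ hij hji := congrArg (c * ·) (hx hij hji)

section LevelSubspace

variable {α : Type*} {r : α → α → Prop} {a b : α}

theorem mem_levelSubspace {y : α → ℝ} :
    y ∈ levelSubspace r ↔ ∀ ⦃i j⦄, r i j → r j i → y i = y j := Iff.rfl

theorem MonotoneAlong.mem_levelSubspace {y : α → ℝ} (hy : MonotoneAlong r y) :
    y ∈ levelSubspace r := fun _ _ hij hji => (hy hij).antisymm (hy hji)

theorem finrank_levelSubspace_of_surjective {β : Type*} [Fintype β] {g : α → β}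
    (hg : Function.Surjective g) (h : ∀ i j, r i j ∧ r j i ↔ g i = g j) :
    Module.finrank ℝ (levelSubspace r) = Fintype.card β := by
  have hrange : levelSubspace r = LinearMap.range (LinearMap.funLeft ℝ ℝ g) := by
    ext y
    rw [mem_levelSubspace, LinearMap.mem_range]
    constructor
    · intro hy
      refine ⟨y ∘ Function.surjInv hg, funext fun i => ?_⟩
      obtain ⟨hij, hji⟩ := (h _ i).2 (Function.surjInv_eq hg (g i))
      exact hy hij hji
    · rintro ⟨z, rfl⟩ i j hij hji
      exact congrArg z ((h i j).1 ⟨hij, hji⟩)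
  rw [hrange, LinearMap.finrank_range_of_inj (LinearMap.funLeft_injective_of_surjective ℝ ℝ g hg),
    Module.finrank_fintype_fun_eq_card]

variable [IsPreorder α r]

theorem levelSubspace_insertRel (hba : ¬ r b a) :
    levelSubspace (insertRel r a b) = levelSubspace r := by
  have htrans : ∀ x y z, r x y → r y z → r x z := fun _ _ _ => trans_of r
  ext y
  simp only [mem_levelSubspace, insertRel]
  grind

theorem mem_levelSubspace_insertRel_of_cover (hab : r a b)
    (hcover : ∀ i, r a i → r i b → r i a ∨ r b i) {y : α → ℝ} :
    y ∈ levelSubspace (insertRel r b a) ↔ y ∈ levelSubspace r ∧ y a = y b := by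
  constructor
  · intro hy
    exact ⟨fun _ _ hij hji => hy (Or.inl hij) (Or.inl hji), hy (Or.inl hab) insertRel_self⟩
  · rintro ⟨hy, hyab⟩ i j hij hji
    have between : ∀ i, r a i → r i b → y i = y a := by
      intro i hai hib
      rcases hcover i hai hib with hia | hbi
      · exact hy hia hai
      · exact (hy hib hbi).trans hyab.symm
    rcases hij with hij | ⟨hib, haj⟩ <;> rcases hji with hji | ⟨hjb, hai⟩
    · exact hy hij hji
    · rw [between i hai (trans_of r hij hjb), between j (trans_of r hai hij) hjb]
    · rw [between i (trans_of r haj hji) hib, between j haj (trans_of r hji hib)]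
    · rw [between i hai hib, between j haj hjb]

theorem finrank_levelSubspace_insertRel_of_cover [Finite α] (hab : r a b) (hba : ¬ r b a)
    (hcover : ∀ i, r a i → r i b → r i a ∨ r b i) :
    Module.finrank ℝ (levelSubspace (insertRel r b a)) + 1 =
      Module.finrank ℝ (levelSubspace r) := by
  classical
  let φ : Module.Dual ℝ (levelSubspace r) :=
    ((LinearMap.proj a : (α → ℝ) →ₗ[ℝ] ℝ) - LinearMap.proj b) ∘ₗ (levelSubspace r).subtype
  have hφ : φ ≠ 0 := by
    have hz : (fun i => if r b i then (1 : ℝ) else 0) ∈ levelSubspace r := fun i j hij hji =>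
      if_congr ⟨fun h => trans_of r h hij, fun h => trans_of r h hji⟩ rfl rfl
    intro h
    simpa [φ, hba, refl_of r b] using LinearMap.congr_fun h ⟨_, hz⟩
  have hker : levelSubspace (insertRel r b a) =
      (LinearMap.ker φ).map (levelSubspace r).subtype := by
    ext y
    rw [mem_levelSubspace_insertRel_of_cover hab hcover]
    simp [φ, sub_eq_zero, and_comm]
  rw [hker, Submodule.finrank_map_subtype_eq, Module.Dual.finrank_ker_add_one_of_ne_zero hφ]

theorem finrank_levelSubspace_insertRel_insertRel [Finite α] (hab : ¬ r a b) (hba : ¬ r b a) :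
    Module.finrank ℝ (levelSubspace (insertRel (insertRel r a b) b a)) + 1 =
      Module.finrank ℝ (levelSubspace r) := by
  rw [← levelSubspace_insertRel hba]
  have _hrefl : ∀ x, r x x := refl_of r
  have htrans : ∀ x y z, r x y → r y z → r x z := fun _ _ _ => trans_of r
  apply finrank_levelSubspace_insertRel_of_cover insertRel_self <;> unfold insertRel <;> grind

end LevelSubspace

section TotalPreorder

theorem strictMonoAlong_le_iff {β γ : Type*} [PartialOrder β] [Preorder γ] {z : β → γ} :
    StrictMonoAlong (· ≤ ·) z ↔ StrictMono z := by
  constructor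
  · exact fun hz i j hij => (hz hij.le).1.lt_of_not_ge fun h => hij.not_ge ((hz hij.le).2 h)
  · exact fun hz i j hij => ⟨hz.monotone hij, fun h => by
      rcases hij.eq_or_lt with rfl | hlt
      · exact le_rfl
      · exact absurd h (hz hlt).not_ge⟩

variable {α β : Type*} {r : α → α → Prop}

theorem MonotoneAlong.exists_comp_eq [Preorder β] {g : α → β} {γ : Type*} [PartialOrder γ]
    {y : α → γ} (hg : Function.Surjective g) (h : ∀ i j, r i j ↔ g i ≤ g j)
    (hy : MonotoneAlong r y) : ∃ z : β → γ, z ∘ g = y := by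
  refine ⟨y ∘ Function.surjInv hg, funext fun i => ?_⟩
  have hi : g (Function.surjInv hg (g i)) = g i := Function.surjInv_eq hg _
  exact (hy ((h _ _).2 hi.le)).antisymm (hy ((h _ _).2 hi.ge))

theorem exists_surjective_fin_of_total [Finite α] [IsPreorder α r] (htotal : ∀ i j, r i j ∨ r j i) :
    ∃ (c : ℕ) (g : α → Fin c), Function.Surjective g ∧ ∀ i j, r i j ↔ g i ≤ g j := by
  classical
  let _ : Preorder α := { le := r, le_refl := refl_of r, le_trans := fun _ _ _ => trans_of r }
  have : @Std.Total α (· ≤ ·) := ⟨htotal⟩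
  have : Finite (Antisymmetrization α (· ≤ ·)) := Quotient.finite _
  let _ := Fintype.ofFinite (Antisymmetrization α (· ≤ ·))
  let e := Fintype.orderIsoFinOfCardEq (Antisymmetrization α (· ≤ ·)) rfl
  refine ⟨_, fun i => e.symm (toAntisymmetrization (· ≤ ·) i),
    e.symm.surjective.comp Quotient.mk_surjective, fun i j => ?_⟩
  rw [e.symm.le_iff_le, toAntisymmetrization_le_toAntisymmetrization_iff]
  rfl

end TotalPreorder

section OrderPolynomial

variable {α : Type*} [Fintype α] {r : α → α → Prop} {a b : α} {m : ℕ} {y : α → ℕ}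

open Classical in
/-- The maps to `{1, …, m}` that are weakly increasing along `r`. -/
noncomputable def monotoneMaps (r : α → α → Prop) (m : ℕ) : Finset (α → ℕ) :=
  (Fintype.piFinset fun _ => Finset.Icc 1 m).filter fun y => MonotoneAlong r y

open Classical in
/-- The maps to `{1, …, m}` that are strictly increasing along `r`. -/
noncomputable def strictMonoMaps (r : α → α → Prop) (m : ℕ) : Finset (α → ℕ) :=
  (Fintype.piFinset fun _ => Finset.Icc 1 m).filter fun y => StrictMonoAlong r y

theorem mem_monotoneMaps :
    y ∈ monotoneMaps r m ↔ (∀ i, 1 ≤ y i ∧ y i ≤ m) ∧ MonotoneAlong r y := by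
  simp [monotoneMaps]

theorem mem_strictMonoMaps :
    y ∈ strictMonoMaps r m ↔ (∀ i, 1 ≤ y i ∧ y i ≤ m) ∧ StrictMonoAlong r y := by
  simp [strictMonoMaps]

theorem card_strictMonoMaps_fin (c m : ℕ) :
    (strictMonoMaps (α := Fin c) (· ≤ ·) m).card = m.choose c := by
  have hmem : ∀ y : Fin c → ℕ, y ∈ strictMonoMaps (· ≤ ·) m ↔
      (∀ i, y i ∈ Finset.Icc 1 m) ∧ StrictMono y := by
    simp [mem_strictMonoMaps, strictMonoAlong_le_iff]
  suffices h : _ = (Finset.powersetCard c (Finset.Icc 1 m)).card by simpa using h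
  refine Finset.card_bij (fun y _ => Finset.univ.image y) ?_ ?_ ?_
  · intro y hy
    obtain ⟨hym, hy⟩ := (hmem y).1 hy
    simpa [Finset.mem_powersetCard, Finset.card_image_of_injective _ hy.injective,
      Finset.image_subset_iff] using hym
  · intro y hy z hz hyz
    have hcard : (Finset.univ.image y).card = c := by
      rw [Finset.card_image_of_injective _ ((hmem y).1 hy).2.injective, Finset.card_fin]
    rw [Finset.orderEmbOfFin_unique hcard (f := y) (by simp) ((hmem y).1 hy).2,
      Finset.orderEmbOfFin_unique hcard (f := z) (by simp [hyz]) ((hmem z).1 hz).2]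
  · intro s hs
    obtain ⟨hsm, hsc⟩ := Finset.mem_powersetCard.1 hs
    refine ⟨s.orderEmbOfFin hsc, (hmem _).2 ⟨fun i => hsm (s.orderEmbOfFin_mem hsc i),
      (s.orderEmbOfFin hsc).strictMono⟩, ?_⟩
    rw [← Finset.coe_inj]
    simp

theorem monotone_sub_val_of_strictMono {c : ℕ} {y : Fin c → ℕ} (hy : StrictMono y) :
    Monotone fun i => (y i : ℤ) - i := by
  obtain _ | c := c
  · exact Subsingleton.monotone _
  · refine Fin.monotone_iff_le_succ.2 fun i => ?_
    have := hy i.castSucc_lt_succ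
    simp only [Fin.val_castSucc, Fin.val_succ]
    omega

theorem val_lt_and_le_add_val_of_strictMono {c m : ℕ} {y : Fin c → ℕ} (hy : StrictMono y)
    (hym : ∀ i, 1 ≤ y i ∧ y i ≤ m + c - 1) (i : Fin c) : i < y i ∧ y i ≤ m + i := by
  obtain _ | c := c
  · exact i.elim0
  · have hzero := monotone_sub_val_of_strictMono hy (Fin.zero_le i)
    have hlast := monotone_sub_val_of_strictMono hy (Fin.le_last i)
    have := (hym 0).1
    have := (hym (Fin.last c)).2
    simp only [Fin.val_zero, Fin.val_last] at hzero hlast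
    omega

theorem card_monotoneMaps_fin (c m : ℕ) :
    (monotoneMaps (α := Fin c) (· ≤ ·) m).card = m.multichoose c := by
  rw [Nat.multichoose_eq, ← card_strictMonoMaps_fin]
  refine Finset.card_nbij' (fun y i => y i + i) (fun y i => y i - i) ?_ ?_ ?_ ?_
  · intro y hy
    obtain ⟨hym, hy⟩ := mem_monotoneMaps.1 hy
    refine mem_strictMonoMaps.2 ⟨fun i => ?_, strictMonoAlong_le_iff.2 fun i j hij => ?_⟩
    · have := hym i
      dsimp only
      omega
    · exact add_lt_add_of_le_of_lt (hy hij.le) hij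
  · intro y hy
    obtain ⟨hym, hy⟩ := mem_strictMonoMaps.1 hy
    rw [strictMonoAlong_le_iff] at hy
    have hbound := val_lt_and_le_add_val_of_strictMono hy hym
    refine mem_monotoneMaps.2 ⟨fun i => ?_, fun i j hij => ?_⟩
    · have := hbound i
      dsimp only
      omega
    · have := monotone_sub_val_of_strictMono hy hij
      have := hbound i
      dsimp only at *
      omega
  · exact fun y _ => funext fun i => Nat.add_sub_cancel (y i) i
  · intro y hy
    obtain ⟨hym, hy⟩ := mem_strictMonoMaps.1 hy
    exact funext fun i => Nat.sub_add_cancel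
      (val_lt_and_le_add_val_of_strictMono (strictMonoAlong_le_iff.1 hy) hym i).1.le

section Surjective

variable {β : Type*} [Fintype β] [Preorder β] {g : α → β}

theorem card_monotoneMaps_of_surjective (hg : Function.Surjective g)
    (h : ∀ i j, r i j ↔ g i ≤ g j) (m : ℕ) :
    (monotoneMaps r m).card = (monotoneMaps (α := β) (· ≤ ·) m).card := by
  classical
  rw [← Finset.card_image_of_injective _ hg.injective_comp_right]
  congr 1
  ext y
  have hmem : ∀ z : β → ℕ, z ∘ g ∈ monotoneMaps r m ↔ z ∈ monotoneMaps (· ≤ ·) m := by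
    simp [mem_monotoneMaps, MonotoneAlong, h, hg.forall]
  rw [Finset.mem_image]
  constructor
  · intro hy
    obtain ⟨z, rfl⟩ := (mem_monotoneMaps.1 hy).2.exists_comp_eq hg h
    exact ⟨z, (hmem z).1 hy, rfl⟩
  · rintro ⟨z, hz, rfl⟩
    exact (hmem z).2 hz

theorem card_strictMonoMaps_of_surjective (hg : Function.Surjective g)
    (h : ∀ i j, r i j ↔ g i ≤ g j) (m : ℕ) :
    (strictMonoMaps r m).card = (strictMonoMaps (α := β) (· ≤ ·) m).card := by
  classical
  rw [← Finset.card_image_of_injective _ hg.injective_comp_right]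
  congr 1
  ext y
  have hmem : ∀ z : β → ℕ, z ∘ g ∈ strictMonoMaps r m ↔ z ∈ strictMonoMaps (· ≤ ·) m := by
    simp [mem_strictMonoMaps, StrictMonoAlong, h, hg.forall]
  rw [Finset.mem_image]
  constructor
  · intro hy
    obtain ⟨z, rfl⟩ := (mem_strictMonoMaps.1 hy).2.monotoneAlong.exists_comp_eq hg h
    exact ⟨z, (hmem z).1 hy, rfl⟩
  · rintro ⟨z, hz, rfl⟩
    exact (hmem z).2 hz

end Surjective

variable [IsPreorder α r]

theorem reciprocal_card_of_total (htotal : ∀ i j, r i j ∨ r j i) :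
    Reciprocal (Module.finrank ℝ (levelSubspace r)) (fun m => (strictMonoMaps r m).card)
      (fun m => (monotoneMaps r m).card) := by
  obtain ⟨c, g, hg, h⟩ := exists_surjective_fin_of_total htotal
  have hfinrank : Module.finrank ℝ (levelSubspace r) = c := by
    rw [finrank_levelSubspace_of_surjective hg fun i j => by rw [h, h, le_antisymm_iff],
      Fintype.card_fin]
  simpa only [hfinrank, card_strictMonoMaps_of_surjective hg h, card_strictMonoMaps_fin,
    card_monotoneMaps_of_surjective hg h, card_monotoneMaps_fin]
    using reciprocal_choose_multichoose c

theorem card_strictMonoMaps_split (hab : ¬ r a b) (hba : ¬ r b a) (m : ℕ) :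
    (strictMonoMaps r m).card =
      (strictMonoMaps (insertRel r a b) m).card + (strictMonoMaps (insertRel r b a) m).card +
        (strictMonoMaps (insertRel (insertRel r a b) b a) m).card := by
  classical
  rw [← Finset.card_union_of_disjoint, ← Finset.card_union_of_disjoint]
  · congr 1
    ext y
    simp only [Finset.mem_union, mem_strictMonoMaps, strictMonoAlong_insertRel hba,
      strictMonoAlong_insertRel hab, strictMonoAlong_insertRel_insertRel hab hba]
    have := lt_trichotomy (y a) (y b)
    tauto
  · rw [Finset.disjoint_left]
    simp only [Finset.mem_union, mem_strictMonoMaps, strictMonoAlong_insertRel hba,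
      strictMonoAlong_insertRel hab, strictMonoAlong_insertRel_insertRel hab hba]
    grind
  · rw [Finset.disjoint_left]
    simp only [mem_strictMonoMaps, strictMonoAlong_insertRel hba, strictMonoAlong_insertRel hab]
    grind

theorem card_monotoneMaps_split (a b : α) (m : ℕ) :
    (monotoneMaps (insertRel r a b) m).card + (monotoneMaps (insertRel r b a) m).card =
      (monotoneMaps r m).card + (monotoneMaps (insertRel (insertRel r a b) b a) m).card := by
  classical
  rw [← Finset.card_union_add_card_inter]
  congr 2
  · ext y
    simp only [Finset.mem_union, mem_monotoneMaps, monotoneAlong_insertRel]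
    have := le_total (y a) (y b)
    tauto
  · ext y
    simp only [Finset.mem_inter, mem_monotoneMaps, monotoneAlong_insertRel]
    tauto

theorem reciprocal_card_strictMonoMaps_monotoneMaps (r : α → α → Prop) [IsPreorder α r] :
    Reciprocal (Module.finrank ℝ (levelSubspace r)) (fun m => (strictMonoMaps r m).card)
      (fun m => (monotoneMaps r m).card) := by
  induction r using preorder_induction with
  | total r htotal => exact reciprocal_card_of_total htotal
  | split r a b hab hba hlt hgt heq =>
    rw [levelSubspace_insertRel hba] at hlt
    rw [levelSubspace_insertRel hab] at hgt
    rw [← finrank_levelSubspace_insertRel_insertRel hab hba] at hlt hgt ⊢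
    exact (hlt.add hgt).add_of_succ heq (card_strictMonoMaps_split hab hba)
      (card_monotoneMaps_split a b)

end OrderPolynomial

/-! ### Braid cones -/

theorem exists_le_mul_of_finite {ι 𝕜 : Type*} [Field 𝕜] [LinearOrder 𝕜] [IsStrictOrderedRing 𝕜]
    {S : Set ι} (hS : S.Finite) {f g : ι → 𝕜} (hf : ∀ s ∈ S, 0 ≤ f s)
    (hfg : ∀ s ∈ S, f s = 0 → g s ≤ 0) : ∃ K : 𝕜, ∀ s ∈ S, g s ≤ K * f s := by
  obtain ⟨K, hK⟩ := (hS.image fun s => g s / f s).bddAbove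
  refine ⟨K, fun s hs => ?_⟩
  rcases (hf s hs).eq_or_lt with h | h
  · simpa [← h] using hfg s hs h.symm
  · exact (div_le_iff₀ h).1 (hK ⟨s, hs, rfl⟩)

/-- The number of elements below `i` in the preorder `r`, as a function of `i`. It is written as a
sum of indicators of principal upper sets. -/
noncomputable def rankFunction {α : Type*} [Fintype α] (r : α → α → Prop) : α → ℝ :=
  ∑ k, Set.indicator {j | r k j} 1

/-- The cone of real functions that are weakly increasing along `r`. -/
def orderCone {α : Type*} (r : α → α → Prop) : Set (α → ℝ) := {y | MonotoneAlong r y}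

/-- The smallest face that contains `y` of a convex cone `C`: the summands in `C` of the multiples
of `y`. -/
def coneFace {E : Type*} [AddCommGroup E] [Module ℝ E] (C : Set E) (y : E) : Set E :=
  {w | w ∈ C ∧ ∃ K : ℝ, K • y - w ∈ C}

section OrderCone

variable {α : Type*} {r : α → α → Prop} {a b : α} {y w : α → ℝ}

theorem indicator_one_le_iff {U : Set α} {i j : α} :
    U.indicator (1 : α → ℝ) i ≤ U.indicator 1 j ↔ (i ∈ U → j ∈ U) := by
  by_cases hi : i ∈ U <;> by_cases hj : j ∈ U <;> simp [hi, hj]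

theorem strictMonoAlong_rankFunction [Fintype α] [IsPreorder α r] :
    StrictMonoAlong r (rankFunction r) := by
  intro i j hij
  simp only [rankFunction, Finset.sum_apply]
  have hle : ∀ k ∈ Finset.univ, Set.indicator {j | r k j} (1 : α → ℝ) i ≤
      Set.indicator {j | r k j} 1 j :=
    fun k _ => indicator_one_le_iff.2 fun hki => trans_of r hki hij
  refine ⟨Finset.sum_le_sum hle, fun hji => ?_⟩
  have heq := (Finset.sum_eq_sum_iff_of_le hle).1 ((Finset.sum_le_sum hle).antisymm hji) j
    (Finset.mem_univ j)
  exact indicator_one_le_iff.1 heq.ge (refl_of r j)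

theorem exists_strictMonoAlong [Finite α] (r : α → α → Prop) [IsPreorder α r] :
    ∃ y : α → ℝ, StrictMonoAlong r y :=
  have := Fintype.ofFinite α
  ⟨rankFunction r, strictMonoAlong_rankFunction⟩

theorem exists_cover [Finite α] [IsPreorder α r] {c : α} (hac : r a c) (hca : ¬ r c a) :
    ∃ b, r a b ∧ ¬ r b a ∧ ∀ i, r a i → r i b → r i a ∨ r b i := by
  obtain ⟨y, hy⟩ := exists_strictMonoAlong r
  obtain ⟨b, ⟨hab, hba⟩, hmin⟩ := Set.exists_min_image {i | r a i ∧ ¬ r i a} y (Set.toFinite _)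
    ⟨c, hac, hca⟩
  refine ⟨b, hab, hba, fun i hai hib => or_iff_not_imp_left.2 fun hia => ?_⟩
  exact (hy hib).2 (hmin i ⟨hai, hia⟩)

theorem mem_coneFace_orderCone [Finite α] (hy : y ∈ orderCone r) :
    w ∈ coneFace (orderCone r) y ↔
      w ∈ orderCone r ∧ ∀ ⦃i j⦄, r i j → y j ≤ y i → w j ≤ w i := by
  refine and_congr_right fun _ => ⟨fun ⟨K, hK⟩ i j hij hji => ?_, fun h => ?_⟩
  · have hKij := hK hij
    simp only [Pi.sub_apply, Pi.smul_apply, hji.antisymm (hy hij)] at hKij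
    linarith
  · obtain ⟨K, hK⟩ := exists_le_mul_of_finite (S := {q : α × α | r q.1 q.2})
      (f := fun q => y q.2 - y q.1) (g := fun q => w q.2 - w q.1) (Set.toFinite _)
      (fun q hq => sub_nonneg.2 (hy hq))
      (fun q hq hq0 => sub_nonpos.2 (h hq (sub_eq_zero.1 hq0).le))
    refine ⟨K, fun i j hij => ?_⟩
    have hKij := hK (i, j) hij
    simp only [Pi.sub_apply, Pi.smul_apply, smul_eq_mul] at hKij ⊢
    linarith

theorem coneFace_orderCone_eq_self_iff [Finite α] [IsPreorder α r] (hy : y ∈ orderCone r) :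
    coneFace (orderCone r) y = orderCone r ↔ StrictMonoAlong r y := by
  constructor
  · intro h i j hij
    obtain ⟨z, hz⟩ := exists_strictMonoAlong r
    have hzface : z ∈ coneFace (orderCone r) y := h.superset hz.monotoneAlong
    exact ⟨hy hij, fun hji => (hz hij).2 (((mem_coneFace_orderCone hy).1 hzface).2 hij hji)⟩
  · intro h
    ext w
    rw [mem_coneFace_orderCone hy]
    exact and_iff_left_of_imp fun hw i j hij hji => hw ((h hij).2 hji)

theorem coneFace_orderCone_of_insertRel [Finite α] [IsPreorder α r] (hab : r a b)
    (hy : StrictMonoAlong (insertRel r b a) y) :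
    coneFace (orderCone r) y = orderCone (insertRel r b a) := by
  obtain ⟨hyr, hyba⟩ := monotoneAlong_insertRel.1 hy.monotoneAlong
  ext w
  rw [mem_coneFace_orderCone hyr]
  constructor
  · rintro ⟨hw, h⟩
    exact monotoneAlong_insertRel.2 ⟨hw, h hab hyba⟩
  · intro hw
    exact ⟨(monotoneAlong_insertRel.1 hw).1, fun i j hij hji => hw ((hy (Or.inl hij)).2 hji)⟩

theorem span_orderCone [Finite α] (r : α → α → Prop) [IsPreorder α r] :
    Submodule.span ℝ (orderCone r) = levelSubspace r := by
  refine le_antisymm (Submodule.span_le.2 fun y hy => hy.mem_levelSubspace) fun w hw => ?_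
  obtain ⟨y, hy⟩ := exists_strictMonoAlong r
  obtain ⟨K, hK⟩ := exists_le_mul_of_finite (S := {q : α × α | r q.1 q.2})
    (f := fun q => y q.2 - y q.1) (g := fun q => w q.1 - w q.2) (Set.toFinite _)
    (fun q hq => sub_nonneg.2 (hy hq).1)
    (fun q hq hq0 => (sub_eq_zero.2 (hw hq ((hy hq).2 (sub_eq_zero.1 hq0).le))).le)
  have hwK : w + K • y ∈ orderCone r := by
    intro i j hij
    have hKij := hK (i, j) hij
    simp only [Pi.add_apply, Pi.smul_apply, smul_eq_mul] at hKij ⊢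
    linarith
  rw [← add_sub_cancel_right w (K • y)]
  exact sub_mem (Submodule.subset_span hwK)
    (Submodule.smul_mem _ K (Submodule.subset_span hy.monotoneAlong))

end OrderCone

/-- A braid cone: a convex cone of functions that is a union of faces of the braid arrangement,
i.e. that depends only on the weak orders of the values of its members. Nonnegative multiples of a
member have a coarser weak order, so that they need not be mentioned. -/
structure IsBraidCone {α : Type*} (C : Set (α → ℝ)) : Prop where
  zero_mem : 0 ∈ C
  add_mem : ∀ ⦃x⦄, x ∈ C → ∀ ⦃y⦄, y ∈ C → x + y ∈ C
  mem_of_coarser : ∀ ⦃x⦄, x ∈ C → ∀ ⦃y : α → ℝ⦄, (∀ i j, x i ≤ x j → y i ≤ y j) → y ∈ C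

/-- The preorder of the inequalities between values that hold throughout `C`. -/
def valueRel {α : Type*} (C : Set (α → ℝ)) : α → α → Prop := fun i j => ∀ x ∈ C, x i ≤ x j

instance {α : Type*} {C : Set (α → ℝ)} : IsPreorder α (valueRel C) where
  refl _ _ _ := le_rfl
  trans _ _ _ hij hjk x hx := (hij x hx).trans (hjk x hx)

namespace IsBraidCone

variable {α : Type*} {C : Set (α → ℝ)}

theorem indicator_superlevel_mem (hC : IsBraidCone C) {x : α → ℝ} (hx : x ∈ C) (t : ℝ) :
    Set.indicator {i | t ≤ x i} 1 ∈ C :=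
  hC.mem_of_coarser hx fun _ _ hij => indicator_one_le_iff.2 fun hi => le_trans hi hij

theorem supClosed_indicator_mem (hC : IsBraidCone C) :
    SupClosed {U : Set α | U.indicator 1 ∈ C} := by
  intro U hU V hV
  have hmem := hC.indicator_superlevel_mem (hC.add_mem hU hV) 1
  change Set.indicator _ 1 ∈ C
  convert hmem using 2
  ext i
  by_cases hi : i ∈ U <;> by_cases hi' : i ∈ V <;> simp [hi, hi']

theorem infClosed_indicator_mem (hC : IsBraidCone C) :
    InfClosed {U : Set α | U.indicator 1 ∈ C} := by
  intro U hU V hV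
  have hmem := hC.indicator_superlevel_mem (hC.add_mem hU hV) 2
  change Set.indicator _ 1 ∈ C
  convert hmem using 2
  ext i
  by_cases hi : i ∈ U <;> by_cases hi' : i ∈ V <;> norm_num [hi, hi']

theorem indicator_mem [Finite α] (hC : IsBraidCone C) {U : Set α}
    (hU : ∀ ⦃i j⦄, valueRel C i j → i ∈ U → j ∈ U) : U.indicator 1 ∈ C := by
  have hsep : ∀ (i : U) (j : ↥Uᶜ), ∃ x ∈ C, x j < x i := by
    intro i j
    by_contra! h
    exact j.2 (hU h i.2)
  choose x hxC hx using hsep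
  have hUeq : U = ⨆ i : U, ⨅ j : ↥Uᶜ, {k | x i j i ≤ x i j k} := by
    ext k
    simp only [Set.iSup_eq_iUnion, Set.iInf_eq_iInter, Set.mem_iUnion, Set.mem_iInter]
    constructor
    · exact fun hk => ⟨⟨k, hk⟩, fun j => le_refl (x ⟨k, hk⟩ j k)⟩
    · rintro ⟨i, hi⟩
      by_contra hk
      exact (hx i ⟨k, hk⟩).not_ge (hi ⟨k, hk⟩)
  have hbot : (⊥ : Set α).indicator 1 ∈ C := by
    rw [Set.bot_eq_empty, Set.indicator_empty']
    exact hC.zero_mem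
  have htop : (⊤ : Set α).indicator 1 ∈ C := by
    simpa using hC.indicator_superlevel_mem hC.zero_mem 0
  rw [hUeq]
  exact hC.supClosed_indicator_mem.iSup_mem hbot fun i =>
    hC.infClosed_indicator_mem.iInf_mem htop fun j => hC.indicator_superlevel_mem (hxC i j) _

theorem eq_orderCone [Finite α] (hC : IsBraidCone C) : C = orderCone (valueRel C) := by
  have := Fintype.ofFinite α
  refine Set.Subset.antisymm (fun x hx _ _ hij => hij x hx) fun y hy => ?_
  have hrank : rankFunction (α := α) (fun i j => y i ≤ y j) ∈ C :=
    Finset.sum_induction _ (· ∈ C) (fun x z hx hz => hC.add_mem hx hz) hC.zero_mem fun k _ =>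
      hC.indicator_mem fun i j hij hki => hki.trans (hy hij)
  have : IsPreorder α fun i j => y i ≤ y j :=
    { refl := fun _ => le_rfl, trans := fun _ _ _ => le_trans }
  have hstrict := strictMonoAlong_rankFunction (r := fun i j => y i ≤ y j)
  refine hC.mem_of_coarser hrank fun i j hij => ?_
  exact (le_total (y i) (y j)).elim id fun hji => (hstrict hji).2 hij

end IsBraidCone

/-! ### Faces and normal cones of polytopes -/

section Polytope

variable {d : ℕ} {P Q F G : Set (Fin d → ℝ)} {w x x' y z : Fin d → ℝ}

theorem pairing_eq_dotProduct (y x : Fin d → ℝ) : pairing y x = x ⬝ᵥ y := rfl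

theorem pairing_add (w z x : Fin d → ℝ) : pairing (w + z) x = pairing w x + pairing z x :=
  dotProduct_add x w z

theorem pairing_neg (w x : Fin d → ℝ) : pairing (-w) x = -pairing w x :=
  dotProduct_neg x w

theorem pairing_smul (K : ℝ) (w x : Fin d → ℝ) : pairing (K • w) x = K * pairing w x :=
  dotProduct_smul K x w

theorem isLinearMap_pairing (y : Fin d → ℝ) : IsLinearMap ℝ (pairing y) where
  map_add x x' := add_dotProduct x x' y
  map_smul c x := smul_dotProduct c x y

theorem maxFace_subset (P : Set (Fin d → ℝ)) (y : Fin d → ℝ) : maxFace P y ⊆ P := fun _ hx => hx.1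

theorem pairing_eq_of_mem_maxFace (hx : x ∈ maxFace P y) (hx' : x' ∈ maxFace P y) :
    pairing y x = pairing y x' :=
  (hx'.2 x hx.1).antisymm (hx.2 x' hx'.1)

theorem mem_maxFace_of_le (hx : x ∈ maxFace P y) (hx' : x' ∈ P)
    (hle : pairing y x ≤ pairing y x') : x' ∈ maxFace P y :=
  ⟨hx', fun u hu => (hx.2 u hu).trans hle⟩

theorem maxFace_eq_self (hy : ∀ x ∈ P, ∀ x' ∈ P, pairing y x = pairing y x') :
    maxFace P y = P :=
  (maxFace_subset P y).antisymm fun x hx => ⟨hx, fun x' hx' => (hy x' hx' x hx).le⟩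

theorem maxFace_add (hy : x ∈ maxFace P y) (hz : x ∈ maxFace P z) :
    maxFace P (y + z) = maxFace P y ∩ maxFace P z := by
  ext u
  constructor
  · intro hu
    have hxu := hu.2 x hy.1
    rw [pairing_add, pairing_add] at hxu
    have hyu := hy.2 u hu.1
    have hzu := hz.2 u hu.1
    exact ⟨mem_maxFace_of_le hy hu.1 (by linarith), mem_maxFace_of_le hz hu.1 (by linarith)⟩
  · rintro ⟨huy, huz⟩
    refine ⟨huy.1, fun v hv => ?_⟩
    rw [pairing_add, pairing_add]
    exact add_le_add (huy.2 v hv) (huz.2 v hv)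

theorem isFace_iff : IsFace P F ↔ F.Nonempty ∧ ∃ y, F = maxFace P y := by
  refine and_congr_right fun ⟨x₀, hx₀⟩ => exists_congr fun a => ⟨?_, ?_⟩
  · rintro ⟨b, hb, rfl⟩
    ext x
    exact ⟨fun hx => ⟨hx.1, fun u hu => (hb u hu).trans hx.2.ge⟩,
      fun hx => ⟨hx.1, (hb x hx.1).antisymm (hx₀.2.ge.trans (hx.2 x₀ hx₀.1))⟩⟩
  · rintro rfl
    refine ⟨pairing a x₀, hx₀.2, ?_⟩
    ext x
    exact ⟨fun hx => ⟨hx.1, pairing_eq_of_mem_maxFace hx hx₀⟩,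
      fun hx => mem_maxFace_of_le hx₀ hx.1 hx.2.ge⟩

theorem IsFace.subset (hF : IsFace P F) : F ⊆ P := by
  obtain ⟨-, y, rfl⟩ := isFace_iff.1 hF
  exact maxFace_subset P y

theorem dim_mono (h : P ⊆ Q) : dim P ≤ dim Q :=
  Submodule.finrank_mono (AffineSubspace.direction_le (affineSpan_mono ℝ h))

theorem mem_maxFace_convexHull_iff {S : Set (Fin d → ℝ)} :
    x ∈ maxFace (convexHull ℝ S) y ↔
      x ∈ convexHull ℝ S ∧ ∀ s ∈ S, pairing y s ≤ pairing y x :=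
  and_congr_right fun _ => ⟨fun h s hs => h s (subset_convexHull ℝ S hs), fun h _ hu =>
    convexHull_min (t := {u | pairing y u ≤ pairing y x}) h
      (convex_halfSpace_le (isLinearMap_pairing y) _) hu⟩

theorem convex_maxFace (hP : Convex ℝ P) (y : Fin d → ℝ) : Convex ℝ (maxFace P y) := by
  intro x hx x' hx' a b ha hb hab
  refine mem_maxFace_of_le hx (hP hx.1 hx'.1 ha hb hab) (le_of_eq ?_)
  rw [(isLinearMap_pairing y).map_add, (isLinearMap_pairing y).map_smul,
    (isLinearMap_pairing y).map_smul, ← pairing_eq_of_mem_maxFace hx hx', ← add_smul, hab,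
    one_smul]

theorem maxFace_convexHull (S : Set (Fin d → ℝ)) (y : Fin d → ℝ) :
    maxFace (convexHull ℝ S) y = convexHull ℝ (S ∩ maxFace (convexHull ℝ S) y) := by
  classical
  refine Set.Subset.antisymm (fun x hx => ?_) <|
    convexHull_min Set.inter_subset_right (convex_maxFace (convex_convexHull ℝ S) y)
  obtain ⟨ι, _, w, s, hw, hw1, hs, rfl⟩ := mem_convexHull_iff_exists_fintype.1 hx.1
  set x := ∑ i, w i • s i
  have hsx : ∀ i, 0 ≤ w i * (pairing y x - pairing y (s i)) := fun i =>
    mul_nonneg (hw i) (sub_nonneg.2 (hx.2 _ (subset_convexHull ℝ S (hs i))))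
  have hsum : ∑ i, w i * (pairing y x - pairing y (s i)) = 0 := by
    have hpairing : pairing y x = ∑ i, w i * pairing y (s i) := by
      simp only [x, pairing_eq_dotProduct, sum_dotProduct, smul_dotProduct, smul_eq_mul]
    simp_rw [mul_sub, Finset.sum_sub_distrib, ← Finset.sum_mul, hw1, one_mul, ← hpairing,
      sub_self]
  have hmem : ∀ i, w i ≠ 0 → s i ∈ maxFace (convexHull ℝ S) y := by
    intro i hi
    have hzero := (Finset.sum_eq_zero_iff_of_nonneg fun i _ => hsx i).1 hsum i (Finset.mem_univ i)
    exact mem_maxFace_of_le hx (subset_convexHull ℝ S (hs i))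
      (sub_eq_zero.1 ((mul_eq_zero.1 hzero).resolve_left hi)).le
  have hcenter : Finset.univ.centerMass w s = x := Finset.centerMass_eq_of_sum_1 _ _ hw1
  rw [← hcenter, ← Finset.centerMass_filter_ne_zero]
  refine Finset.centerMass_mem_convexHull _ (fun i _ => hw i) ?_ fun i hi =>
    ⟨hs i, hmem i (Finset.mem_filter.1 hi).2⟩
  rw [Finset.sum_filter_ne_zero, hw1]
  exact one_pos

theorem IsPolytope.maxFace_nonempty (hP : IsPolytope P) (y : Fin d → ℝ) :
    (maxFace P y).Nonempty := by
  obtain ⟨S, hS, hne, rfl⟩ := hP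
  obtain ⟨s, hs, hmax⟩ := Set.exists_max_image S (pairing y) hS hne
  exact ⟨s, mem_maxFace_convexHull_iff.2 ⟨subset_convexHull ℝ S hs, hmax⟩⟩

theorem IsPolytope.isFace_maxFace (hP : IsPolytope P) (y : Fin d → ℝ) :
    IsFace P (maxFace P y) :=
  isFace_iff.2 ⟨hP.maxFace_nonempty y, y, rfl⟩

theorem IsPolytope.finite_setOf_isFace (hP : IsPolytope P) : {F | IsFace P F}.Finite := by
  obtain ⟨S, hS, -, rfl⟩ := hP
  refine (hS.finite_subsets.image (convexHull ℝ)).subset fun F hF => ?_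
  obtain ⟨-, y, rfl⟩ := isFace_iff.1 hF
  exact ⟨_, Set.inter_subset_left, (maxFace_convexHull S y).symm⟩

theorem IsPolytope.exists_mem_maxFace_add_smul (hP : IsPolytope P)
    (hx : x ∈ maxFace (maxFace P z) w) : ∃ K : ℝ, x ∈ maxFace P (w + K • z) := by
  obtain ⟨S, hS, -, rfl⟩ := hP
  have hSP := subset_convexHull ℝ S
  obtain ⟨K, hK⟩ := exists_le_mul_of_finite (f := fun s => pairing z x - pairing z s)
    (g := fun s => pairing w s - pairing w x) hS (fun s hs => sub_nonneg.2 (hx.1.2 s (hSP hs)))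
    (fun s hs hs0 => sub_nonpos.2 (hx.2 s
      (mem_maxFace_of_le hx.1 (hSP hs) (sub_eq_zero.1 hs0).le)))
  refine ⟨K, mem_maxFace_convexHull_iff.2 ⟨hx.1.1, fun s hs => ?_⟩⟩
  simp only [pairing_add, pairing_smul]
  have hKs := hK s hs
  linarith

theorem IsPolytope.exists_maxFace_add_smul_eq (hP : IsPolytope P)
    (hne : (maxFace (maxFace P z) w).Nonempty) :
    ∃ K : ℝ, maxFace P (w + K • z) = maxFace (maxFace P z) w := by
  obtain ⟨x, hx⟩ := hne
  obtain ⟨K, hK⟩ := hP.exists_mem_maxFace_add_smul hx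
  refine ⟨K + 1, ?_⟩
  rw [add_smul, one_smul, ← add_assoc, maxFace_add hK hx.1]
  have hpairing : ∀ u ∈ maxFace P z,
      pairing (w + K • z) u - pairing w u = pairing (w + K • z) x - pairing w x := by
    intro u hu
    simp only [pairing_add, pairing_smul, pairing_eq_of_mem_maxFace hu hx.1]
    ring
  ext u
  constructor
  · rintro ⟨huK, huz⟩
    exact mem_maxFace_of_le hx huz
      (by linarith [hpairing u huz, pairing_eq_of_mem_maxFace huK hK])
  · intro hu
    exact ⟨mem_maxFace_of_le hK hu.1.1
      (by linarith [hpairing u hu.1, pairing_eq_of_mem_maxFace hu hx]), hu.1⟩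

theorem IsPolytope.exists_maxFace_add_smul_eq_of_const (hP : IsPolytope P)
    (hw : ∀ x ∈ maxFace P z, ∀ x' ∈ maxFace P z, pairing w x = pairing w x') :
    ∃ K : ℝ, maxFace P (w + K • z) = maxFace P z := by
  have hself := maxFace_eq_self hw
  obtain ⟨K, hK⟩ := hP.exists_maxFace_add_smul_eq (hself.symm ▸ hP.maxFace_nonempty z)
  exact ⟨K, hK.trans hself⟩

theorem IsPolytope.isFace_maxFace_iff (hP : IsPolytope P) :
    IsFace (maxFace P y) F ↔ IsFace P F ∧ F ⊆ maxFace P y := by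
  constructor
  · intro hF
    obtain ⟨hne, w, rfl⟩ := isFace_iff.1 hF
    obtain ⟨K, hK⟩ := hP.exists_maxFace_add_smul_eq hne
    exact ⟨isFace_iff.2 ⟨hne, _, hK.symm⟩, maxFace_subset _ _⟩
  · rintro ⟨⟨hne, a, b, hb, rfl⟩, hsub⟩
    refine ⟨hne, a, b, fun x hx => hb x hx.1, ?_⟩
    ext x
    exact ⟨fun hx => ⟨hsub hx, hx.2⟩, fun hx => ⟨hx.1.1, hx.2⟩⟩

end Polytope

section NormalCone

variable {d : ℕ} {P F : Set (Fin d → ℝ)} {y : Fin d → ℝ}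

theorem mem_normalCone : y ∈ normalCone P F ↔ F ⊆ maxFace P y := Iff.rfl

theorem mem_normalCone_maxFace (P : Set (Fin d → ℝ)) (y : Fin d → ℝ) :
    y ∈ normalCone P (maxFace P y) := mem_normalCone.2 Set.Subset.rfl

theorem IsPolytope.normalCone_maxFace (hP : IsPolytope P) (hF : F.Nonempty)
    (hy : y ∈ normalCone P F) : normalCone P (maxFace P y) = coneFace (normalCone P F) y := by
  obtain ⟨x₀, hx₀⟩ := hF
  ext w
  constructor
  · intro hw
    have hconst : ∀ x ∈ maxFace P y, ∀ x' ∈ maxFace P y, pairing (-w) x = pairing (-w) x' := by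
      intro x hx x' hx'
      rw [pairing_neg, pairing_neg, pairing_eq_of_mem_maxFace (hw hx) (hw hx')]
    obtain ⟨K, hK⟩ := hP.exists_maxFace_add_smul_eq_of_const hconst
    refine ⟨(mem_normalCone.1 hy).trans hw, K, ?_⟩
    rw [sub_eq_neg_add]
    exact (mem_normalCone.1 hy).trans hK.superset
  · rintro ⟨hw, K, hK⟩ x hx
    have hle := (hK hx₀).2 x hx.1
    rw [sub_eq_neg_add] at hle
    simp only [pairing_add, pairing_neg, pairing_smul, pairing_eq_of_mem_maxFace hx (hy hx₀)]
      at hle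
    exact mem_maxFace_of_le (hw hx₀) hx.1 (by linarith)

theorem IsPolytope.maxFace_eq_iff (hP : IsPolytope P) (hF : IsFace P F) :
    maxFace P y = F ↔
      y ∈ normalCone P F ∧ coneFace (normalCone P F) y = normalCone P F := by
  constructor
  · rintro rfl
    exact ⟨mem_normalCone_maxFace P y,
      (hP.normalCone_maxFace hF.1 (mem_normalCone_maxFace P y)).symm⟩
  · rintro ⟨hy, hface⟩
    rw [← hP.normalCone_maxFace hF.1 hy] at hface
    obtain ⟨-, z, rfl⟩ := isFace_iff.1 hF
    have hz : z ∈ normalCone P (maxFace P y) := hface.superset (mem_normalCone_maxFace P z)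
    exact Set.Subset.antisymm hz hy

theorem maxFace_eq_self_of_neg_mem_normalCone (hF : F.Nonempty) (hy : y ∈ normalCone P F)
    (hneg : -y ∈ normalCone P F) : maxFace P y = P := by
  obtain ⟨x₀, hx₀⟩ := hF
  refine (maxFace_subset P y).antisymm fun x hx => mem_maxFace_of_le (hy hx₀) hx ?_
  have hle := (hneg hx₀).2 x hx
  rwa [pairing_neg, pairing_neg, neg_le_neg_iff] at hle

theorem mem_dualAnnihilator_vectorSpan_iff {𝕜 V : Type*} [CommRing 𝕜] [AddCommGroup V]
    [Module 𝕜 V] {s : Set V} {φ : Module.Dual 𝕜 V} :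
    φ ∈ (vectorSpan 𝕜 s).dualAnnihilator ↔ ∀ x ∈ s, ∀ x' ∈ s, φ x = φ x' := by
  rw [vectorSpan_def, ← SetLike.mem_coe, Submodule.coe_dualAnnihilator_span]
  simp only [Set.mem_ofPred_eq, Set.vsub_subset_iff, vsub_eq_sub, SetLike.mem_coe,
    LinearMap.mem_ker, map_sub, sub_eq_zero]

theorem IsPolytope.mem_span_normalCone_iff (hP : IsPolytope P) (hF : IsFace P F)
    {w : Fin d → ℝ} : w ∈ Submodule.span ℝ (normalCone P F) ↔
      ∀ x ∈ F, ∀ x' ∈ F, pairing w x = pairing w x' := by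
  constructor
  · intro hw x hx x' hx'
    induction hw using Submodule.span_induction with
    | mem w hw => exact pairing_eq_of_mem_maxFace (hw hx) (hw hx')
    | zero => simp only [pairing_eq_dotProduct, dotProduct_zero]
    | add v w _ _ hv hw => rw [pairing_add, pairing_add, hv, hw]
    | smul c w _ hw => rw [pairing_smul, pairing_smul, hw]
  · intro hw
    obtain ⟨-, z, rfl⟩ := isFace_iff.1 hF
    obtain ⟨K, hK⟩ := hP.exists_maxFace_add_smul_eq_of_const hw
    rw [← add_sub_cancel_right w (K • z)]
    exact sub_mem (Submodule.subset_span hK.superset)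
      (Submodule.smul_mem _ K (Submodule.subset_span (mem_normalCone_maxFace P z)))

theorem IsPolytope.finrank_span_normalCone_add_dim (hP : IsPolytope P) (hF : IsFace P F) :
    Module.finrank ℝ (Submodule.span ℝ (normalCone P F)) + dim F = d := by
  have hmap : (Submodule.span ℝ (normalCone P F)).map (dotProductEquiv ℝ (Fin d)).toLinearMap =
      (vectorSpan ℝ F).dualAnnihilator := by
    ext φ
    obtain ⟨w, rfl⟩ := (dotProductEquiv ℝ (Fin d)).surjective φ
    rw [mem_dualAnnihilator_vectorSpan_iff]
    simp only [Submodule.mem_map_equiv, LinearEquiv.symm_apply_apply,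
      hP.mem_span_normalCone_iff hF, pairing_eq_dotProduct, dotProductEquiv_apply_apply,
      dotProduct_comm w]
  rw [← LinearEquiv.finrank_map_eq (dotProductEquiv ℝ (Fin d)), dim, direction_affineSpan, hmap,
    add_comm, Subspace.finrank_add_finrank_dualAnnihilator_eq, Module.finrank_fin_fun]

end NormalCone

/-! ### Generalized permutahedra -/

section StdPermutahedron

variable {d : ℕ} {y : Fin d → ℝ} {σ τ : Equiv.Perm (Fin d)}

/-- The vertex `(σ(1), …, σ(d))` of the standard permutahedron. The values of `Fin d` start at `0`,
whence the shift. -/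
def permVertex (σ : Equiv.Perm (Fin d)) : Fin d → ℝ := fun i => ((σ i : ℕ) : ℝ) + 1

theorem stdPermutahedron_eq_convexHull (d : ℕ) :
    stdPermutahedron d = convexHull ℝ (Set.range permVertex) := rfl

theorem exists_monovary_permVertex (y : Fin d → ℝ) : ∃ σ, Monovary y (permVertex σ) := by
  refine ⟨(Tuple.sort y)⁻¹, fun i j hij => ?_⟩
  have hlt : (Tuple.sort y)⁻¹ i < (Tuple.sort y)⁻¹ j := by simpa [permVertex] using hij
  simpa using Tuple.monotone_sort y hlt.le

theorem permVertex_eq_comp (σ τ : Equiv.Perm (Fin d)) :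
    permVertex τ = permVertex σ ∘ (σ⁻¹ * τ : Equiv.Perm (Fin d)) := by
  funext i
  simp [permVertex]

theorem pairing_permVertex_le (hσ : Monovary y (permVertex σ)) (τ : Equiv.Perm (Fin d)) :
    pairing y (permVertex τ) ≤ pairing y (permVertex σ) := by
  rw [permVertex_eq_comp σ τ]
  simpa only [pairing, mul_comm _ (y _), Function.comp_apply]
    using hσ.sum_mul_comp_perm_le_sum_mul (σ := σ⁻¹ * τ)

theorem pairing_permVertex_eq_iff (hσ : Monovary y (permVertex σ)) :
    pairing y (permVertex τ) = pairing y (permVertex σ) ↔ Monovary y (permVertex τ) := by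
  rw [permVertex_eq_comp σ τ]
  simpa only [pairing, mul_comm _ (y _), Function.comp_apply]
    using hσ.sum_mul_comp_perm_eq_sum_mul_iff (σ := σ⁻¹ * τ)

theorem permVertex_mem_maxFace_iff :
    permVertex τ ∈ maxFace (stdPermutahedron d) y ↔ Monovary y (permVertex τ) := by
  obtain ⟨σ, hσ⟩ := exists_monovary_permVertex y
  rw [← pairing_permVertex_eq_iff hσ, stdPermutahedron_eq_convexHull, mem_maxFace_convexHull_iff,
    Set.forall_mem_range, and_iff_right (subset_convexHull ℝ _ (Set.mem_range_self τ))]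
  exact ⟨fun h => (pairing_permVertex_le hσ τ).antisymm (h σ),
    fun h ρ => (pairing_permVertex_le hσ ρ).trans h.ge⟩

theorem maxFace_stdPermutahedron_subset {y' : Fin d → ℝ} (h : ∀ i j, y i ≤ y j → y' i ≤ y' j) :
    maxFace (stdPermutahedron d) y ⊆ maxFace (stdPermutahedron d) y' := by
  rw [stdPermutahedron_eq_convexHull, maxFace_convexHull _ y, maxFace_convexHull _ y',
    ← stdPermutahedron_eq_convexHull]
  refine convexHull_mono ?_
  rintro _ ⟨⟨τ, rfl⟩, hτ⟩
  have hmono := permVertex_mem_maxFace_iff.1 hτ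
  exact ⟨⟨τ, rfl⟩, permVertex_mem_maxFace_iff.2 fun i j hij => h i j (hmono hij)⟩

end StdPermutahedron

theorem isBraidCone_normalCone {d : ℕ} {P F : Set (Fin d → ℝ)} (hP : IsGeneralizedPermutahedron P)
    (hF : IsFace P F) : IsBraidCone (normalCone P F) where
  zero_mem x hx := ⟨hF.subset hx, fun u _ => by simp only [pairing_eq_dotProduct, dotProduct_zero,
    le_refl]⟩
  add_mem y hy z hz x hx := by
    rw [maxFace_add (hy hx) (hz hx)]
    exact ⟨hy hx, hz hx⟩
  mem_of_coarser y hy y' h := by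
    obtain ⟨S, hS, hN⟩ := hP.2 _ ⟨F, hF, rfl⟩
    rw [hN] at hy ⊢
    obtain ⟨N, hNS, hyN⟩ := hy
    obtain ⟨G, -, rfl⟩ := hS hNS
    exact ⟨_, hNS, hyN.trans (maxFace_stdPermutahedron_subset h)⟩

theorem exists_normalCone_eq_orderCone {d : ℕ} {P F : Set (Fin d → ℝ)}
    (hP : IsGeneralizedPermutahedron P) (hF : IsFace P F) :
    ∃ r, IsPreorder (Fin d) r ∧ normalCone P F = orderCone r :=
  ⟨_, inferInstance, (isBraidCone_normalCone hP hF).eq_orderCone⟩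

section Faces

variable {d k : ℕ} {P F : Set (Fin d → ℝ)} {r : Fin d → Fin d → Prop} {y : Fin d → ℝ}

section NormalPreorder

variable [IsPreorder (Fin d) r]

theorem IsPolytope.maxFace_eq_iff_strictMonoAlong (hP : IsPolytope P) (hF : IsFace P F)
    (hr : normalCone P F = orderCone r) : maxFace P y = F ↔ StrictMonoAlong r y := by
  rw [hP.maxFace_eq_iff hF, hr]
  exact ⟨fun ⟨hy, hface⟩ => (coneFace_orderCone_eq_self_iff hy).1 hface,
    fun hy => ⟨hy.monotoneAlong, (coneFace_orderCone_eq_self_iff hy.monotoneAlong).2 hy⟩⟩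

theorem IsPolytope.finrank_levelSubspace_add_dim (hP : IsPolytope P) (hF : IsFace P F)
    (hr : normalCone P F = orderCone r) :
    Module.finrank ℝ (levelSubspace r) + dim F = d := by
  rw [← span_orderCone, ← hr, hP.finrank_span_normalCone_add_dim hF]

theorem IsPolytope.exists_rel_not_rel_of_dim_lt (hP : IsPolytope P) (hF : IsFace P F)
    (hr : normalCone P F = orderCone r) (hdim : dim F < dim P) : ∃ a b, r a b ∧ ¬ r b a := by
  by_contra! hsymm
  obtain ⟨y, hy⟩ := exists_strictMonoAlong r
  have hneg : -y ∈ normalCone P F := by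
    rw [hr]
    exact fun i j hij => neg_le_neg (hy (hsymm i j hij)).1
  have hPF := maxFace_eq_self_of_neg_mem_normalCone hF.1 (hr ▸ hy.monotoneAlong) hneg
  rw [(hP.maxFace_eq_iff_strictMonoAlong hF hr).2 hy] at hPF
  exact hdim.ne (congrArg dim hPF)

end NormalPreorder

theorem exists_isFace_dim_eq_zero (hP : IsGeneralizedPermutahedron P) :
    ∃ F, IsFace P F ∧ dim F = 0 := by
  let y : Fin d → ℝ := fun i => (i : ℕ)
  have hF := hP.1.isFace_maxFace y
  obtain ⟨r, _, hr⟩ := exists_normalCone_eq_orderCone hP hF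
  have hy : MonotoneAlong r y := hr.subset (mem_normalCone_maxFace P y)
  have htop : levelSubspace r = ⊤ := by
    refine eq_top_iff.2 fun w _ i j hij hji => ?_
    rw [Fin.ext (Nat.cast_injective ((hy hij).antisymm (hy hji)))]
  have hdim := hP.1.finrank_levelSubspace_add_dim hF hr
  rw [htop, finrank_top, Module.finrank_fin_fun] at hdim
  exact ⟨_, hF, by omega⟩

theorem exists_isFace_dim_eq_succ (hP : IsGeneralizedPermutahedron P) (hF : IsFace P F)
    (hlt : dim F < dim P) : ∃ G, IsFace P G ∧ dim G = dim F + 1 := by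
  obtain ⟨r, _, hr⟩ := exists_normalCone_eq_orderCone hP hF
  obtain ⟨a, c, hac, hca⟩ := hP.1.exists_rel_not_rel_of_dim_lt hF hr hlt
  obtain ⟨b, hab, hba, hcover⟩ := exists_cover hac hca
  obtain ⟨y, hy⟩ := exists_strictMonoAlong (insertRel r b a)
  have hyF : y ∈ normalCone P F := hr ▸ (monotoneAlong_insertRel.1 hy.monotoneAlong).1
  have hG := hP.1.isFace_maxFace y
  have hrG : normalCone P (maxFace P y) = orderCone (insertRel r b a) := by
    rw [hP.1.normalCone_maxFace hF.1 hyF, hr, coneFace_orderCone_of_insertRel hab hy]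
  have hdimF := hP.1.finrank_levelSubspace_add_dim hF hr
  have hdimG := hP.1.finrank_levelSubspace_add_dim hG hrG
  have hfinrank := finrank_levelSubspace_insertRel_of_cover hab hba hcover
  exact ⟨_, hG, by omega⟩

theorem exists_isFace_dim_eq (hP : IsGeneralizedPermutahedron P) (hk : k ≤ dim P) :
    ∃ F, IsFace P F ∧ dim F = k := by
  induction k with
  | zero => exact exists_isFace_dim_eq_zero hP
  | succ k ih =>
    obtain ⟨F, hF, rfl⟩ := ih (Nat.le_of_succ_le hk)
    exact exists_isFace_dim_eq_succ hP hF hk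

theorem numFaces_eq_zero_of_dim_lt (hk : dim P < k) : numFaces k P = 0 := by
  have hempty : {F | IsFace P F ∧ dim F = k} = ∅ :=
    Set.eq_empty_of_forall_notMem fun F ⟨hF, hdim⟩ =>
      (hdim.symm.le.trans (dim_mono hF.subset)).not_gt hk
  rw [numFaces, hempty, Set.ncard_empty]

theorem chi_eq_zero_of_dim_lt (hk : dim P < k) (m : ℕ) : chi k P m = 0 := by
  rw [chi, Finset.card_filter_eq_zero_iff]
  exact fun y _ => ((dim_mono (maxFace_subset P (toDir y))).trans_lt hk).ne

theorem monotoneAlong_toDir_iff {y : Fin d → ℕ} :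
    MonotoneAlong r (toDir y) ↔ MonotoneAlong r y := by
  simp only [MonotoneAlong, toDir, Nat.cast_le]

theorem strictMonoAlong_toDir_iff {y : Fin d → ℕ} :
    StrictMonoAlong r (toDir y) ↔ StrictMonoAlong r y := by
  simp only [StrictMonoAlong, toDir, Nat.cast_le]

theorem mem_box {d m : ℕ} {y : Fin d → ℕ} : y ∈ box d m ↔ ∀ i, 1 ≤ y i ∧ y i ≤ m := by
  simp [box]

open Classical in
theorem reciprocal_card_maxFace_eq (hP : IsGeneralizedPermutahedron P) (hF : IsFace P F) :
    Reciprocal (d - dim F) (fun m => {y ∈ box d m | maxFace P (toDir y) = F}.card)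
      (fun m => {y ∈ box d m | F ⊆ maxFace P (toDir y)}.card) := by
  obtain ⟨r, _, hr⟩ := exists_normalCone_eq_orderCone hP hF
  have hstrict : ∀ m, {y ∈ box d m | maxFace P (toDir y) = F} = strictMonoMaps r m := fun m =>
    Finset.ext fun y => by
      rw [Finset.mem_filter, hP.1.maxFace_eq_iff_strictMonoAlong hF hr, strictMonoAlong_toDir_iff,
        mem_strictMonoMaps, mem_box]
  have hweak : ∀ m, {y ∈ box d m | F ⊆ maxFace P (toDir y)} = monotoneMaps r m := fun m =>
    Finset.ext fun y => by
      rw [Finset.mem_filter, mem_monotoneMaps, mem_box, ← monotoneAlong_toDir_iff]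
      exact and_congr_right fun _ => Set.ext_iff.1 hr (toDir y)
  simp only [hstrict, hweak, Nat.sub_eq_of_eq_add (hP.1.finrank_levelSubspace_add_dim hF hr).symm]
  exact reciprocal_card_strictMonoMaps_monotoneMaps r

theorem reciprocal_chi_sum_numFaces (hP : IsGeneralizedPermutahedron P) (hk : k ≤ dim P) :
    Reciprocal (d - k) (chi k P)
      (fun m => ∑ y ∈ box d m, numFaces k (maxFace P (toDir y))) := by
  classical
  have hfinite : {F | IsFace P F ∧ dim F = k}.Finite :=
    hP.1.finite_setOf_isFace.subset fun F hF => hF.1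
  set T := hfinite.toFinset
  have hT : ∀ {F}, F ∈ T ↔ IsFace P F ∧ dim F = k := by simp [T]
  have hne : T.Nonempty := (exists_isFace_dim_eq hP hk).imp fun F hF => hT.2 hF
  have hchi : chi k P = ∑ F ∈ T, fun m => {y ∈ box d m | maxFace P (toDir y) = F}.card := by
    funext m
    rw [chi, Finset.sum_apply, Finset.card_eq_sum_card_fiberwise (t := T)
      (f := fun y => maxFace P (toDir y)) ?_]
    · refine Finset.sum_congr rfl fun F hF => congrArg Finset.card ?_
      ext y
      have := (hT.1 hF).2
      grind
    · intro y hy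
      exact hT.2 ⟨hP.1.isFace_maxFace _, (Finset.mem_filter.1 hy).2⟩
  have hnumFaces : ∀ y, numFaces k (maxFace P y) = {F ∈ T | F ⊆ maxFace P y}.card := by
    intro y
    rw [numFaces, ← Set.ncard_coe_finset]
    congr 1
    ext F
    simp only [Finset.coe_filter, hT, Set.mem_ofPred_eq, hP.1.isFace_maxFace_iff]
    tauto
  have hsum : (fun m => ∑ y ∈ box d m, numFaces k (maxFace P (toDir y))) =
      ∑ F ∈ T, fun m => {y ∈ box d m | F ⊆ maxFace P (toDir y)}.card := by
    funext m
    simp only [Finset.sum_apply, hnumFaces]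
    exact Finset.sum_card_bipartiteAbove_eq_sum_card_bipartiteBelow
      fun y F => F ⊆ maxFace P (toDir y)
  rw [hchi, hsum]
  refine Reciprocal.sum hne fun F hF => ?_
  rw [← (hT.1 hF).2]
  exact reciprocal_card_maxFace_eq hP (hT.1 hF).1

end Faces

end GenPerm

theorem mainTheorem1 {d k : ℕ} (hk : k < d) (P : Set (Fin d → ℝ))
    (hP : GenPerm.IsGeneralizedPermutahedron P) :
    ∃ p : Polynomial ℚ,
      (∀ m : ℕ, 0 < m → p.eval (m : ℚ) = (GenPerm.chi k P m : ℚ)) ∧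
      (k ≤ GenPerm.dim P → p.degree = ((d - k : ℕ) : WithBot ℕ)) ∧
      (GenPerm.dim P < k → p = 0) ∧
      (∀ m : ℕ, 0 < m →
        (-1 : ℚ) ^ (d - k) * p.eval (-(m : ℚ)) =
          ∑ y ∈ GenPerm.box d m,
            (GenPerm.numFaces k (GenPerm.maxFace P (GenPerm.toDir y)) : ℚ)) := by
  rcases le_or_gt k (GenPerm.dim P) with hkP | hkP
  · obtain ⟨p, hchi, hfaces, hdegree, hlead⟩ := GenPerm.reciprocal_chi_sum_numFaces hP hkP
    refine ⟨p, hchi, fun _ => ?_, fun h => absurd hkP h.not_ge, fun m hm => ?_⟩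
    · exact (Polynomial.degree_le_of_natDegree_le hdegree).antisymm
        (Polynomial.le_degree_of_ne_zero hlead.ne')
    · exact_mod_cast hfaces m hm
  · have hfaces : ∀ y, GenPerm.numFaces k (GenPerm.maxFace P y) = 0 := fun y =>
      GenPerm.numFaces_eq_zero_of_dim_lt
        ((GenPerm.dim_mono (GenPerm.maxFace_subset P y)).trans_lt hkP)
    exact ⟨0, by simp [GenPerm.chi_eq_zero_of_dim_lt hkP], fun h => absurd h hkP.not_ge,
      fun _ => rfl, by simp [hfaces]⟩
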